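/- Let $r\ge 1$, let $m_{i,j}$ be a positive integer for each $1\le i<j\le r+1$, and put $M=\sum_{1\le i<j\le r+1}m_{i,j}$. Let $e_1,\dots,e_{r+1}$ be the standard basis of $\mathbb{R}^{r+1}$, and for $a=(a_1,\dots,a_r)$ with all $a_i\ge 0$ let $$P(a)=\Big\{(y_{i,j,k})\in\mathbb{R}^M \;\Big|\; y_{i,j,k}\ge 0,\ \sum_{1\le i<j\le r+1}\ \sum_{1\le k\le m_{i,j}} y_{i,j,k}(e_i-e_j)=\sum_{i=1}^r a_i(e_i-e_{r+1})\Big\}$$ be the flow polytope. Its volume is taken with respect to the quotient measure $du/da$ on the affine space $\{y\in\mathbb{R}^M \mid \sum y_{i,j,k}(e_i-e_j)=\sum_i a_i(e_i-e_{r+1})\}$, where $du$ is the Lebesgue measure on $\mathbb{R}^M$ and $da=da_1\cdots da_r$. Put $\partial_i=\partial/\partial a_i$ and consider, for real polynomials $\phi$ in $a_1,\dots,a_r$, the system $$\Big(\prod_{j=i+1}^{r}(\partial_i-\partial_j)^{m_{i,j}}\Big)\,\partial_i^{m_{i,r+1}}\,\phi=0\qquad(i=1,\dots,r).\tag{$*$}$$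 1. If $\phi$ is homogeneous of degree $d$, satisfies $(*)$, and $d>M-r$, then $\phi=0$. 2. For every integer $d$ with $0\le d\le M-r$ there is a nonzero homogeneous polynomial of degree $d$ satisfying $(*)$. 3. There is a polynomial $v$ in $a_1,\dots,a_r$ whose value at $a$ is the volume of $P(a)$ for every $a$ in the closure $\{a\mid a_1,\dots,a_r\ge 0\}$ of the nice chamber $\{a\mid a_1,\dots,a_r>0\}$, and every homogeneous polynomial $\phi$ of degree $d=M-r$ satisfying $(*)$ is a constant multiple of $v$. -/

import Mathlib

open MeasureTheory

noncomputable section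

namespace FlowPolytope

/-! Nodes are indexed by `Fin (r + 1)`; the node `r + 1` of the mathematical notation is
`Fin.last r`, and the coordinates `a_1, …, a_r` are indexed by `Fin r`, embedded into the nodes
by `Fin.castSucc`.  Only the values `m i j` with `i < j` are ever used. -/

/-- The total multiplicity `M`, the sum of the `m i j` over all `i < j`. -/
def totalMult (r : ℕ) (m : Fin (r + 1) → Fin (r + 1) → ℕ) : ℕ :=
  ∑ i, ∑ j ∈ Finset.Ioi i, m i j

/-- The index set of the triples `(i, j, k)` with `i < j` and `k` one of `m i j` values. -/
abbrev Arc (r : ℕ) (m : Fin (r + 1) → Fin (r + 1) → ℕ) : Type :=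
  Σ p : {p : Fin (r + 1) × Fin (r + 1) // p.1 < p.2}, Fin (m p.1.1 p.1.2)

/-- The vector `e_i - e_j` of `ℝ^(r+1)`. -/
def root {r : ℕ} (i j : Fin (r + 1)) : Fin (r + 1) → ℝ :=
  Pi.single i 1 - Pi.single j 1

/-- The positive root attached to the arc `(i, j, k)`. -/
def arcRoot {r : ℕ} {m : Fin (r + 1) → Fin (r + 1) → ℕ} (e : Arc r m) : Fin (r + 1) → ℝ :=
  root e.1.1.1 e.1.1.2

/-- The linear map `ℝ^M → ℝ^(r+1)`, `y ↦ ∑ y_{i,j,k} (e_i - e_j)`. -/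
def rootSum {r : ℕ} {m : Fin (r + 1) → Fin (r + 1) → ℕ} (y : Arc r m → ℝ) : Fin (r + 1) → ℝ :=
  ∑ e, y e • arcRoot e

/-- The vector `a_1 e_1 + ⋯ + a_r e_r - (a_1 + ⋯ + a_r) e_{r+1} = ∑ a_i (e_i - e_{r+1})`. -/
def toV {r : ℕ} (a : Fin r → ℝ) : Fin (r + 1) → ℝ :=
  ∑ i : Fin r, a i • root i.castSucc (Fin.last r)

/-- The flow polytope of `a`. -/
def flowPolytope (r : ℕ) (m : Fin (r + 1) → Fin (r + 1) → ℕ) (a : Fin r → ℝ) :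
    Set (Arc r m → ℝ) :=
  {y | (∀ e, 0 ≤ y e) ∧ rootSum y = toV a}

/-- The arcs `(i, r+1, k)` where `k` is the first of its `m i (r+1)` values.  If all
multiplicities are positive, their roots `e_i - e_{r+1}` are a basis of the root lattice. -/
def IsBasic {r : ℕ} {m : Fin (r + 1) → Fin (r + 1) → ℕ} (e : Arc r m) : Prop :=
  e.1.1.2 = Fin.last r ∧ (e.2 : ℕ) = 0

instance {r : ℕ} {m : Fin (r + 1) → Fin (r + 1) → ℕ} :
    DecidablePred (IsBasic : Arc r m → Prop) :=
  fun _ => inferInstanceAs (Decidable (_ ∧ _))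

/-- The point of the fibre `{y | rootSum y = toV a}` with prescribed coordinates `z` at the
non-basic arcs; the equation determines the remaining coordinates. -/
def fibrePoint {r : ℕ} {m : Fin (r + 1) → Fin (r + 1) → ℕ} (a : Fin r → ℝ)
    (z : {e : Arc r m // ¬ IsBasic e} → ℝ) : Arc r m → ℝ := fun e =>
  if h : IsBasic e then
    toV a e.1.1.1 - ∑ f : {e : Arc r m // ¬ IsBasic e}, z f * arcRoot f.1 e.1.1.1
  else z ⟨e, h⟩

/-- The quotient measure `du / da` on the fibre `{y | rootSum y = toV a}`, where `du` is the
Lebesgue measure of `ℝ^M` and `da = da_1 ⋯ da_r` is the measure given by the root lattice.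
The map `(a, z) ↦ fibrePoint a z` has determinant `±1`, so this is the Lebesgue measure in the
coordinates `z`.  That these measures are carried by the fibres, are translates of each other, and
satisfy `du = (du / da) da` is proved in `fibreMeasure_compl`, `map_add_fibreMeasure` and
`lintegral_fibreMeasure` below. -/
def fibreMeasure (r : ℕ) (m : Fin (r + 1) → Fin (r + 1) → ℕ) (a : Fin r → ℝ) :
    Measure (Arc r m → ℝ) :=
  (volume : Measure ({e : Arc r m // ¬ IsBasic e} → ℝ)).map (fibrePoint a)

section Disintegration

variable {r : ℕ} {m : Fin (r + 1) → Fin (r + 1) → ℕ}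

theorem toV_castSucc (a : Fin r → ℝ) (i : Fin r) : toV a i.castSucc = a i := by
  simp [toV, root, Finset.sum_apply, Pi.single_apply, Fin.castSucc_ne_last]

theorem sum_toV (a : Fin r → ℝ) : ∑ i, toV a i = 0 := by
  simp only [toV, Finset.sum_apply, Pi.smul_apply, smul_eq_mul]
  rw [Finset.sum_comm]
  refine Finset.sum_eq_zero fun i _ => ?_
  simp [← Finset.mul_sum, root]

theorem sum_rootSum (y : Arc r m → ℝ) : ∑ i, rootSum y i = 0 := by
  simp only [rootSum, Finset.sum_apply, Pi.smul_apply, smul_eq_mul]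
  rw [Finset.sum_comm]
  refine Finset.sum_eq_zero fun i _ => ?_
  simp [← Finset.mul_sum, arcRoot, root]

theorem rootSum_add (y w : Arc r m → ℝ) : rootSum (y + w) = rootSum y + rootSum w := by
  simp [rootSum, add_smul, Finset.sum_add_distrib]

/-- The basic arc leaving the node `i`. -/
def basicArc (hm : ∀ i j, i < j → 0 < m i j) (i : Fin r) : {e : Arc r m // IsBasic e} :=
  ⟨⟨⟨(i.castSucc, Fin.last r), Fin.castSucc_lt_last i⟩,
    ⟨0, hm _ _ (Fin.castSucc_lt_last i)⟩⟩, rfl, rfl⟩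

theorem basicArc_bijective (hm : ∀ i j, i < j → 0 < m i j) :
    Function.Bijective (basicArc hm) := by
  constructor
  · intro i j h
    have h1 : (basicArc hm i).1.1.1.1 = (basicArc hm j).1.1.1.1 := by rw [h]
    exact Fin.castSucc_injective r h1
  · rintro ⟨⟨⟨⟨i, j⟩, hij⟩, ⟨k, hk⟩⟩, h1, h2⟩
    dsimp only at h1 h2 hij hk
    subst h1 h2
    exact ⟨i.castPred hij.ne, rfl⟩

/-- The numbering of the basic arcs by the nodes that they leave. -/
def basicEquiv (hm : ∀ i j, i < j → 0 < m i j) : Fin r ≃ {e : Arc r m // IsBasic e} :=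
  Equiv.ofBijective _ (basicArc_bijective hm)

theorem rootSum_castSucc (hm : ∀ i j, i < j → 0 < m i j) (y : Arc r m → ℝ) (i : Fin r) :
    rootSum y i.castSucc = y (basicArc hm i).1
      + ∑ f : {e : Arc r m // ¬ IsBasic e}, y f * arcRoot f.1 i.castSucc := by
  have h : rootSum y i.castSucc = ∑ e, y e * arcRoot e i.castSucc := by
    simp [rootSum, Finset.sum_apply]
  rw [h, ← Fintype.sum_subtype_add_sum_subtype (fun e : Arc r m => IsBasic e)]
  congr 1
  rw [← (basicEquiv hm).sum_comp, Finset.sum_eq_single i]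
  · simp [basicEquiv, basicArc, arcRoot, root, Fin.castSucc_ne_last]
  · intro j _ hj
    simp [basicEquiv, basicArc, arcRoot, root, Fin.castSucc_ne_last, hj.symm]
  · simp

theorem eq_of_castSucc {x w : Fin (r + 1) → ℝ} (hx : ∑ i, x i = 0) (hw : ∑ i, w i = 0)
    (h : ∀ i : Fin r, x i.castSucc = w i.castSucc) : x = w := by
  rw [Fin.sum_univ_castSucc] at hx hw
  funext i
  refine Fin.lastCases ?_ h i
  simp only [h] at hx
  linarith

theorem fibrePoint_basicArc (hm : ∀ i j, i < j → 0 < m i j) (a : Fin r → ℝ)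
    (z : {e : Arc r m // ¬ IsBasic e} → ℝ) (i : Fin r) :
    fibrePoint a z (basicArc hm i).1
      = a i - ∑ f : {e : Arc r m // ¬ IsBasic e}, z f * arcRoot f.1 i.castSucc := by
  rw [fibrePoint, dif_pos (basicArc hm i).2, ← toV_castSucc a i]
  rfl

theorem fibrePoint_nonbasic (a : Fin r → ℝ)
    (z : {e : Arc r m // ¬ IsBasic e} → ℝ) (f : {e : Arc r m // ¬ IsBasic e}) :
    fibrePoint a z f.1 = z f := by
  rw [fibrePoint, dif_neg f.2]

theorem rootSum_fibrePoint (hm : ∀ i j, i < j → 0 < m i j) (a : Fin r → ℝ)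
    (z : {e : Arc r m // ¬ IsBasic e} → ℝ) : rootSum (fibrePoint a z) = toV a := by
  refine eq_of_castSucc (sum_rootSum _) (sum_toV _) fun i => ?_
  rw [rootSum_castSucc hm, fibrePoint_basicArc, toV_castSucc]
  simp [fibrePoint_nonbasic]

theorem fibrePoint_eq (hm : ∀ i j, i < j → 0 < m i j) (a : Fin r → ℝ) (y : Arc r m → ℝ)
    (h : rootSum y = toV a) : fibrePoint a (fun f => y f.1) = y := by
  funext e
  by_cases he : IsBasic e
  · obtain ⟨i, hi⟩ := (basicArc_bijective hm).2 ⟨e, he⟩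
    have h2 : (basicArc hm i).1 = e := by rw [hi]
    rw [← h2, fibrePoint_basicArc, ← toV_castSucc a, ← h, rootSum_castSucc hm]
    simp
  · exact fibrePoint_nonbasic a _ ⟨e, he⟩

theorem measurable_fibrePoint_uncurry :
    Measurable (fun p : (Fin r → ℝ) × ({e : Arc r m // ¬ IsBasic e} → ℝ) =>
      fibrePoint p.1 p.2) := by
  refine measurable_pi_lambda _ fun e => ?_
  by_cases he : IsBasic e
  · simp only [fibrePoint, he, dif_pos, toV, Finset.sum_apply, Pi.smul_apply, smul_eq_mul]
    fun_prop
  · simp only [fibrePoint, he, dif_neg, not_false_iff]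
    fun_prop

theorem measurable_fibrePoint (a : Fin r → ℝ) :
    Measurable (fibrePoint a : ({e : Arc r m // ¬ IsBasic e} → ℝ) → _) :=
  measurable_fibrePoint_uncurry.comp measurable_prodMk_left

/-- The fibre measure is carried by the fibre. -/
theorem fibreMeasure_compl (hm : ∀ i j, i < j → 0 < m i j) (a : Fin r → ℝ) :
    fibreMeasure r m a {y | rootSum y = toV a}ᶜ = 0 := by
  have hs : MeasurableSet {y : Arc r m → ℝ | rootSum y = toV a}ᶜ := by
    refine (measurableSet_eq_fun ?_ measurable_const).compl
    unfold rootSum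
    fun_prop
  rw [fibreMeasure, Measure.map_apply (measurable_fibrePoint a) hs]
  simp [rootSum_fibrePoint hm]

/-- The fibre measures are translates of each other. -/
theorem map_add_fibreMeasure (hm : ∀ i j, i < j → 0 < m i j) (a b : Fin r → ℝ)
    (y : Arc r m → ℝ) (hy : rootSum y = toV b) :
    (fibreMeasure r m a).map (fun x => x + y) = fibreMeasure r m (a + b) := by
  have key : (fun x => x + y) ∘ (fibrePoint a : ({e : Arc r m // ¬ IsBasic e} → ℝ) → _)
      = fibrePoint (a + b) ∘ fun z => z + fun f => y f.1 := by
    funext z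
    have h : rootSum (fibrePoint a z + y) = toV (a + b) := by
      rw [rootSum_add, rootSum_fibrePoint hm, hy]
      simp [toV, add_smul, Finset.sum_add_distrib]
    have := fibrePoint_eq hm _ _ h
    simp only [Function.comp]
    rw [← this]
    congr 1
    funext f
    simp [fibrePoint_nonbasic]
  rw [fibreMeasure, Measure.map_map (by fun_prop) (measurable_fibrePoint a), key,
    ← Measure.map_map (measurable_fibrePoint _) (by fun_prop), map_add_right_eq_self]
  rfl

theorem measurePreserving_fibrePoint (hm : ∀ i j, i < j → 0 < m i j) :
    MeasurePreserving (fun p : (Fin r → ℝ) × ({e : Arc r m // ¬ IsBasic e} → ℝ) =>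
      fibrePoint p.1 p.2) (volume.prod volume) volume := by
  have h1 : MeasurePreserving
      (fun p : ({e : Arc r m // ¬ IsBasic e} → ℝ) × (Fin r → ℝ) =>
        (p.1, fun i : Fin r => p.2 i
          - ∑ f : {e : Arc r m // ¬ IsBasic e}, p.1 f * arcRoot f.1 i.castSucc))
      (volume.prod volume) (volume.prod volume) := by
    refine (MeasurePreserving.id volume).skew_product (g := fun (z : {e : Arc r m // ¬ IsBasic e} → ℝ) (a : Fin r → ℝ) => fun i : Fin r => a i
          - ∑ f : {e : Arc r m // ¬ IsBasic e}, z f * arcRoot f.1 i.castSucc) ?_ ?_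
    · fun_prop
    · exact Filter.Eventually.of_forall fun z => (measurePreserving_sub_right volume
        (fun i : Fin r =>
          ∑ f : {e : Arc r m // ¬ IsBasic e}, z f * arcRoot f.1 i.castSucc)).map_eq
  have h2 := (volume_measurePreserving_piCongrLeft (fun _ => ℝ) (basicEquiv hm)).prod
    (MeasurePreserving.id (volume : Measure ({e : Arc r m // ¬ IsBasic e} → ℝ)))
  have h3 := (volume_preserving_piEquivPiSubtypeProd (fun _ : Arc r m => ℝ) IsBasic).symm
  have h := h3.comp (h2.comp (Measure.measurePreserving_swap.comp
    (h1.comp Measure.measurePreserving_swap)))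
  refine (congrArg (fun G => MeasurePreserving G (volume.prod volume) volume) ?_).mpr h
  funext p e
  by_cases he : IsBasic e
  · obtain ⟨i, hi⟩ := (basicArc_bijective hm).2 ⟨e, he⟩
    have h4 : (basicArc hm i).1 = e := by rw [hi]
    have h5 : (basicEquiv hm).symm ⟨e, he⟩ = i := by
      rw [Equiv.symm_apply_eq, ← hi]; rfl
    have h6 : fibrePoint p.1 p.2 e = p.1 i
        - ∑ f : {e : Arc r m // ¬ IsBasic e}, p.2 f * arcRoot f.1 i.castSucc := by
      rw [← fibrePoint_basicArc hm, h4]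
    rw [h6]
    simp [he, h5, MeasurableEquiv.piEquivPiSubtypeProd, Equiv.piEquivPiSubtypeProd,
      MeasurableEquiv.piCongrLeft, Equiv.piCongrLeft, Equiv.piCongrLeft']
  · simp [he, fibrePoint, MeasurableEquiv.piEquivPiSubtypeProd, Equiv.piEquivPiSubtypeProd]

/-- The fibre measures disintegrate the Lebesgue measure of `ℝ^M` over `da_1 ⋯ da_r`. -/
theorem lintegral_fibreMeasure (hm : ∀ i j, i < j → 0 < m i j) (F : (Arc r m → ℝ) → ENNReal)
    (hF : Measurable F) : ∫⁻ y, F y = ∫⁻ a, ∫⁻ y, F y ∂(fibreMeasure r m a) := by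
  rw [← (measurePreserving_fibrePoint hm).lintegral_comp hF,
    lintegral_prod (fun p : (Fin r → ℝ) × ({e : Arc r m // ¬ IsBasic e} → ℝ) =>
      F (fibrePoint p.1 p.2)) (hF.comp measurable_fibrePoint_uncurry).aemeasurable]
  refine lintegral_congr fun a => ?_
  rw [fibreMeasure, lintegral_map hF (measurable_fibrePoint a)]

end Disintegration

/-- The volume of the flow polytope of `a` with respect to the quotient measure. -/
def flowVolume (r : ℕ) (m : Fin (r + 1) → Fin (r + 1) → ℕ) (a : Fin r → ℝ) : ℝ :=
  (fibreMeasure r m a).real (flowPolytope r m a)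

/-- The nice chamber, in the coordinates `a_1, …, a_r`. -/
def niceChamber (r : ℕ) : Set (Fin r → ℝ) := {a | ∀ i, 0 < a i}

/-- `v` is the polynomial that coincides with the volume of the flow polytope on the closure of
the nice chamber. -/
def IsNiceVolumePolynomial (r : ℕ) (m : Fin (r + 1) → Fin (r + 1) → ℕ)
    (v : MvPolynomial (Fin r) ℝ) : Prop :=
  ∀ a ∈ closure (niceChamber r), MvPolynomial.eval a v = flowVolume r m a

/-- The operator `∂_i = ∂/∂a_i` on polynomials in `a_1, …, a_r`. -/
def partialOp {r : ℕ} (i : Fin r) : Module.End ℝ (MvPolynomial (Fin r) ℝ) :=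
  (MvPolynomial.pderiv i).toLinearMap

/-- The operator `(∂_i - ∂_{i+1})^{m_{i,i+1}} ⋯ (∂_i - ∂_r)^{m_{i,r}} ∂_i^{m_{i,r+1}}`
(a composition of operators, the factors in this order). -/
def systemOp (r : ℕ) (m : Fin (r + 1) → Fin (r + 1) → ℕ) (i : Fin r) :
    Module.End ℝ (MvPolynomial (Fin r) ℝ) :=
  (((List.finRange r).filter (fun j => i < j)).map
      (fun j => (partialOp i - partialOp j) ^ m i.castSucc j.castSucc)).prod
    * partialOp i ^ m i.castSucc (Fin.last r)

/-- The system of the `r` differential equations. -/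
def SolvesSystem (r : ℕ) (m : Fin (r + 1) → Fin (r + 1) → ℕ)
    (φ : MvPolynomial (Fin r) ℝ) : Prop :=
  ∀ i : Fin r, systemOp r m i φ = 0

end FlowPolytope

end

noncomputable section

namespace FlowPolytope

open MvPolynomial

/-! ### Constant coefficient differential operators and their symbols -/

section Symbols

variable {r : ℕ}

/-! All operators have constant coefficients, so they commute and can be handled through their
symbols. With x_{r+1} = 0, the symbol of the i-th equation is the product of x_i - x_j over the arcs
leaving i. Let n_i be the number of these arcs, so that the n_i add up to M.

Upper bound: order exponents lexicographically, with x_1 the largest variable, and let α be the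
smallest exponent of a nonzero solution. If α_i ≥ n_i, the i-th equation read at α - n_i e_i
involves only the coefficient at α and coefficients at smaller exponents, so the coefficient at α
would vanish. Hence α_i ≤ n_i - 1 for all i (`SolvesSystem.exists_coeff_ne_zero`), which bounds the
degree by M - r. In degree M - r equality holds throughout, so α is forced and a solution is
determined by one coefficient (`SolvesSystem.eq_C_mul`).

Existence: set aside one arc to the sink from each node; its flow is the slack in an inequality on
the other flows. Integrate these out in order of source. An arc from s to t contributes an
antiderivative along e_s - e_t from 0 to a_s, because no later arc enters s (`volume_chainRegion`).
The i-th operator undoes the antiderivatives of the arcs leaving i, and its last factor ∂_i, from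
the slack arc, kills what remains (`symbolHom_chainPoly_eq_zero`). Thus the volume is a nonzero
homogeneous solution of degree M - r, and its derivatives give solutions in all lower degrees. -/

theorem partialOp_apply (i : Fin r) (p : MvPolynomial (Fin r) ℝ) : partialOp i p = pderiv i p :=
  rfl

theorem partialOp_comm (i j : Fin r) : partialOp i * partialOp j = partialOp j * partialOp i := by
  ext1 s
  ext t
  simp only [LinearMap.comp_apply, Module.End.mul_apply, partialOp_apply, coeff_pderiv]
  by_cases h : i = j
  · simp [h]
  · simp only [Finsupp.add_apply, Finsupp.single_eq_of_ne h, Finsupp.single_eq_of_ne (Ne.symm h),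
      add_zero, add_right_comm _ (Finsupp.single i 1)]
    ring

/-- The algebra homomorphism that sends a polynomial to the differential operator of which it
is the symbol. -/
def symbolHom (r : ℕ) :
    MvPolynomial (Fin r) ℝ →ₐ[ℝ] Module.End ℝ (MvPolynomial (Fin r) ℝ) :=
  -- `aeval` needs a commutative target, which the endomorphism ring is not. The map is built into
  -- the subalgebra generated by the ∂_i, then composed with the inclusion.
  have hcomm := Algebra.isMulCommutative_adjoin ℝ (s := Set.range (partialOp (r := r))) (by
    rintro _ ⟨i, rfl⟩ _ ⟨j, rfl⟩
    exact partialOp_comm i j)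
  letI : CommRing (Algebra.adjoin ℝ (Set.range (partialOp (r := r)))) :=
    { (Algebra.adjoin ℝ (Set.range (partialOp (r := r)))).toRing with
      mul_comm := hcomm.is_comm.comm }
  (Algebra.adjoin ℝ (Set.range (partialOp (r := r)))).val.comp
    (aeval fun i => ⟨partialOp i, Algebra.subset_adjoin ⟨i, rfl⟩⟩)

@[simp]
theorem symbolHom_X (i : Fin r) : symbolHom r (X i) = partialOp i := by
  simp [symbolHom]

/-- The variable attached to a node; it is zero at the last node. -/
def nodeVar (t : Fin (r + 1)) : MvPolynomial (Fin r) ℝ :=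
  Fin.lastCases (motive := fun _ => MvPolynomial (Fin r) ℝ) 0 X t

@[simp]
theorem nodeVar_last : nodeVar (Fin.last r) = 0 := by
  simp [nodeVar]

@[simp]
theorem nodeVar_castSucc (i : Fin r) : nodeVar i.castSucc = X i := by
  simp [nodeVar]

end Symbols

/-! ### The system in terms of arcs -/

section System

variable {r : ℕ} {m : Fin (r + 1) → Fin (r + 1) → ℕ}

/-- The arcs that leave the node `i`. -/
def arcsFrom (m : Fin (r + 1) → Fin (r + 1) → ℕ) (i : Fin r) : Finset (Arc r m) :=
  Finset.univ.filter fun e => e.1.1.1 = i.castSucc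

theorem prod_arc {N : Type*} [CommMonoid N] (g : Fin (r + 1) → Fin (r + 1) → N) :
    ∏ e : Arc r m, g e.1.1.1 e.1.1.2 = ∏ i, ∏ j ∈ Finset.Ioi i, g i j ^ m i j := by
  rw [Fintype.prod_sigma]
  simp only [Finset.prod_const, Finset.card_univ, Fintype.card_fin]
  rw [← Finset.prod_subtype (Finset.univ.filter fun p : Fin (r + 1) × Fin (r + 1) => p.1 < p.2)
    (by simp) (fun p => g p.1 p.2 ^ m p.1 p.2), Finset.prod_filter, Fintype.prod_prod_type]
  refine Finset.prod_congr rfl fun i _ => ?_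
  rw [← Finset.prod_filter]
  refine Finset.prod_congr ?_ fun _ _ => rfl
  ext j
  simp

theorem prod_arcsFrom {N : Type*} [CommMonoid N] (i : Fin r) (g : Fin (r + 1) → N) :
    ∏ e ∈ arcsFrom m i, g e.1.1.2 = ∏ j ∈ Finset.Ioi i.castSucc, g j ^ m i.castSucc j := by
  rw [arcsFrom, Finset.prod_filter,
    prod_arc (m := m) (fun a b => if a = i.castSucc then g b else 1),
    Finset.prod_eq_single i.castSucc]
  · simp
  · intro b _ hb
    simp [hb]
  · simp

theorem card_arc : Fintype.card (Arc r m) = totalMult r m := by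
  -- A product in `Multiplicative ℕ` is a sum in ℕ, so constant factors count arcs.
  have h := prod_arc (m := m) (fun _ _ => Multiplicative.ofAdd 1)
  apply_fun Multiplicative.toAdd at h
  simpa [totalMult] using h

theorem sum_card_arcsFrom : ∑ i : Fin r, (arcsFrom m i).card = totalMult r m := by
  rw [← card_arc, ← Finset.card_univ, Finset.card_eq_sum_card_fiberwise (t := Finset.univ)
    (f := fun e : Arc r m => e.1.1.1) (fun _ _ => by simp), Fin.sum_univ_castSucc]
  rw [show (Finset.univ.filter fun e : Arc r m => e.1.1.1 = Fin.last r) = ∅ from ?_]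
  · simp [arcsFrom]
  · refine Finset.filter_eq_empty_iff.2 fun e _ h => ?_
    exact absurd (h ▸ e.1.2) (Fin.le_last _).not_gt

/-- The symbol of the `i`-th operator of the system. -/
def systemSymbol (m : Fin (r + 1) → Fin (r + 1) → ℕ) (i : Fin r) : MvPolynomial (Fin r) ℝ :=
  ∏ e ∈ arcsFrom m i, (X i - nodeVar e.1.1.2)

/-- Since the variable of the last node is 0, the factor ∂_i^{m_{i,r+1}} has the same shape as the
others, and all arcs leaving i can be treated alike. -/
theorem systemOp_eq (i : Fin r) : systemOp r m i = symbolHom r (systemSymbol m i) := by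
  rw [systemSymbol, prod_arcsFrom i (fun j => X i - nodeVar j)]
  have h : Finset.Ioi i.castSucc = Finset.univ.filter (fun j => i.castSucc < j) := by
    ext; simp
  rw [h, Finset.prod_filter, Fin.prod_univ_castSucc]
  simp only [Fin.castSucc_lt_castSucc_iff, Fin.castSucc_lt_last, if_true, nodeVar_last,
    nodeVar_castSucc, sub_zero]
  rw [← Finset.prod_filter, map_mul, map_pow, symbolHom_X, systemOp]
  congr 1
  have h2 : (Finset.univ.filter fun j : Fin r => i < j)
      = ((List.finRange r).filter (fun j => i < j)).toFinset := by
    ext; simp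
  rw [h2, List.prod_toFinset _ ((List.nodup_finRange r).filter _), map_list_prod, List.map_map]
  congr 2
  funext j
  simp

theorem solvesSystem_iff {φ : MvPolynomial (Fin r) ℝ} :
    SolvesSystem r m φ ↔ ∀ i, symbolHom r (systemSymbol m i) φ = 0 := by
  simp only [SolvesSystem, systemOp_eq]

end System

/-! ### The lexicographically smallest exponent of a solution -/

section Lex

variable {r : ℕ} {m : Fin (r + 1) → Fin (r + 1) → ℕ}

/-- The operator with symbol `p` sees, at the lexicographically smallest place, only the
coefficient that `∂_i ^ n` would see. -/
def HasLeadingPower (i : Fin r) (p : MvPolynomial (Fin r) ℝ) (n : ℕ) : Prop :=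
  ∀ (φ : MvPolynomial (Fin r) ℝ) (α : Fin r →₀ ℕ),
    (∀ γ, MonomialOrder.lex.toSyn γ < MonomialOrder.lex.toSyn (α + Finsupp.single i n) →
      coeff γ φ = 0) →
    (∀ γ, MonomialOrder.lex.toSyn γ < MonomialOrder.lex.toSyn α →
      coeff γ (symbolHom r p φ) = 0) ∧
    (coeff α (symbolHom r p φ) = 0 → coeff (α + Finsupp.single i n) φ = 0)

theorem hasLeadingPower_one (i : Fin r) : HasLeadingPower i 1 0 := by
  intro φ α h
  simpa using h

/-- The operator of q acts first. The vanishing it yields below the shifted exponent is exactly the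
hypothesis needed for p; this is why the definition has two conclusions. -/
theorem HasLeadingPower.mul {i : Fin r} {p q : MvPolynomial (Fin r) ℝ} {k l : ℕ}
    (hp : HasLeadingPower i p k) (hq : HasLeadingPower i q l) :
    HasLeadingPower i (p * q) (k + l) := by
  intro φ α h
  rw [Finsupp.single_add, ← add_assoc] at *
  obtain ⟨h1, h2⟩ := hq φ _ h
  obtain ⟨h3, h4⟩ := hp _ _ h1
  rw [map_mul]
  exact ⟨h3, fun h5 => h2 (h4 h5)⟩

theorem lex_single_lt {i j : Fin r} (h : i < j) :
    MonomialOrder.lex.toSyn (Finsupp.single j 1) < MonomialOrder.lex.toSyn (Finsupp.single i 1) := by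
  rw [MonomialOrder.lex_lt_iff]
  exact ⟨i, fun k hk => by simp [hk.ne', (hk.trans h).ne'], by simp [h.ne']⟩

/-- For γ ≤ α, the t-derivative at γ reads φ at γ + e_t, which lies below α + e_i because t > i.
Only the ∂_i term survives at α, with the positive factor α_i + 1. -/
theorem hasLeadingPower_root {i : Fin r} {t : Fin (r + 1)} (h : i.castSucc < t) :
    HasLeadingPower i (X i - nodeVar t) 1 := by
  intro φ α hφ
  have key : ∀ γ, MonomialOrder.lex.toSyn γ ≤ MonomialOrder.lex.toSyn α →
      coeff γ (symbolHom r (nodeVar t) φ) = 0 := by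
    intro γ hγ
    induction t using Fin.lastCases with
    | last => simp
    | cast j =>
      rw [nodeVar_castSucc, symbolHom_X, partialOp_apply, coeff_pderiv, hφ, zero_mul]
      rw [map_add, map_add]
      exact add_lt_add_of_le_of_lt hγ (lex_single_lt (Fin.castSucc_lt_castSucc_iff.1 h))
  simp only [map_sub, LinearMap.sub_apply, coeff_sub, symbolHom_X, partialOp_apply, coeff_pderiv]
  refine ⟨fun γ hγ => ?_, fun h0 => ?_⟩
  · rw [key γ hγ.le, hφ, zero_mul, sub_zero]
    rw [map_add, map_add]
    exact add_lt_add_of_lt_of_le hγ le_rfl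
  · rw [key α le_rfl, sub_zero] at h0
    exact (mul_eq_zero.1 h0).resolve_right (by positivity)

theorem hasLeadingPower_systemSymbol (i : Fin r) :
    HasLeadingPower i (systemSymbol m i) (arcsFrom m i).card := by
  have h : ∀ s ⊆ arcsFrom m i,
      HasLeadingPower i (∏ e ∈ s, (X i - nodeVar e.1.1.2)) s.card := by
    intro s
    induction s using Finset.induction_on with
    | empty => exact fun _ => hasLeadingPower_one i
    | insert e s he ih =>
      intro hs
      rw [Finset.prod_insert he, Finset.card_insert_of_notMem he, add_comm s.card]
      refine (hasLeadingPower_root ?_).mul (ih ((Finset.subset_insert _ _).trans hs))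
      have h1 : e.1.1.1 = i.castSucc := (Finset.mem_filter.1 (hs (Finset.mem_insert_self e s))).2
      exact h1 ▸ e.1.2
  exact h _ subset_rfl

/-- A nonzero solution has a nonzero coefficient at an exponent that is smaller, in each
variable, than the order of the corresponding equation. -/
theorem SolvesSystem.exists_coeff_ne_zero {φ : MvPolynomial (Fin r) ℝ} (h : SolvesSystem r m φ)
    (h0 : φ ≠ 0) : ∃ α : Fin r →₀ ℕ, coeff α φ ≠ 0 ∧ ∀ i, α i + 1 ≤ (arcsFrom m i).card := by
  obtain ⟨α, hα, hmin⟩ := Finset.exists_min_image φ.support MonomialOrder.lex.toSyn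
    (support_nonempty.2 h0)
  refine ⟨α, mem_support_iff.1 hα, fun i => ?_⟩
  by_contra! hi
  have hi : Finsupp.single i (arcsFrom m i).card ≤ α := by
    rw [Finsupp.single_le_iff]
    omega
  -- The equation is read at α - n_i e_i, whose leading place is α itself; minimality of α supplies
  -- the vanishing below it.
  have h1 := hasLeadingPower_systemSymbol (m := m) i φ
    (α - Finsupp.single i (arcsFrom m i).card)
  rw [tsub_add_cancel_of_le hi] at h1
  refine mem_support_iff.1 hα ((h1 fun γ hγ => ?_).2 ?_)
  · by_contra h2
    exact (hmin γ (mem_support_iff.2 h2)).not_gt hγ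
  · rw [solvesSystem_iff.1 h i, coeff_zero]

theorem SolvesSystem.degree_add_le {φ : MvPolynomial (Fin r) ℝ} (h : SolvesSystem r m φ)
    (h0 : φ ≠ 0) {d : ℕ} (hd : φ.IsHomogeneous d) : d + r ≤ totalMult r m := by
  obtain ⟨α, hα, hle⟩ := h.exists_coeff_ne_zero h0
  have h1 : ∑ i, α i = d := by
    rw [← Finsupp.degree_eq_sum]
    by_contra h2
    exact hα (hd.coeff_eq_zero h2)
  have h2 := Finset.sum_le_sum fun i (_ : i ∈ Finset.univ) => hle i
  rw [sum_card_arcsFrom, Finset.sum_add_distrib, h1] at h2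
  simpa using h2

/-- The exponent of the leading coefficient of the solutions of top degree. -/
theorem SolvesSystem.coeff_top_ne_zero {φ : MvPolynomial (Fin r) ℝ} (h : SolvesSystem r m φ)
    (h0 : φ ≠ 0) {d : ℕ} (hd : φ.IsHomogeneous d) (hM : d + r = totalMult r m) :
    coeff (Finsupp.equivFunOnFinite.symm fun i => (arcsFrom m i).card - 1) φ ≠ 0 := by
  obtain ⟨α, hα, hle⟩ := h.exists_coeff_ne_zero h0
  have h1 : ∑ i, α i = d := by
    rw [← Finsupp.degree_eq_sum]
    by_contra h2
    exact hα (hd.coeff_eq_zero h2)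
  have h2 : ∑ i, (α i + 1) = ∑ i, (arcsFrom m i).card := by
    rw [sum_card_arcsFrom, Finset.sum_add_distrib, h1]
    simpa using hM
  -- Termwise inequalities with equal sums are equalities, so α is determined.
  have h3 := (Finset.sum_eq_sum_iff_of_le fun i (_ : i ∈ Finset.univ) => hle i).1 h2
  convert hα using 2
  ext i
  have := h3 i (Finset.mem_univ i)
  simp only [Finsupp.equivFunOnFinite_symm_apply_apply]
  omega

theorem SolvesSystem.sub_C_mul {φ ψ : MvPolynomial (Fin r) ℝ} (hφ : SolvesSystem r m φ)
    (hψ : SolvesSystem r m ψ) (c : ℝ) : SolvesSystem r m (φ - C c * ψ) := by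
  intro i
  rw [C_mul', map_sub, map_smul, hφ i, hψ i, smul_zero, sub_zero]

/-- The solutions of top degree are unique up to a constant. -/
theorem SolvesSystem.eq_C_mul {φ v : MvPolynomial (Fin r) ℝ} {d : ℕ} (hφ : SolvesSystem r m φ)
    (hv : SolvesSystem r m v) (hφd : φ.IsHomogeneous d) (hvd : v.IsHomogeneous d) (hv0 : v ≠ 0)
    (hM : d + r = totalMult r m) : ∃ c : ℝ, φ = C c * v := by
  have h1 := hv.coeff_top_ne_zero hv0 hvd hM
  set α := Finsupp.equivFunOnFinite.symm fun i => (arcsFrom m i).card - 1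
  -- This constant cancels the coefficient at α, which a nonzero solution of top degree cannot lack.
  refine ⟨coeff α φ / coeff α v, sub_eq_zero.1 ?_⟩
  by_contra h2
  refine (hφ.sub_C_mul hv _).coeff_top_ne_zero h2 (hφd.sub (hvd.C_mul _)) hM ?_
  rw [coeff_sub, coeff_C_mul, div_mul_cancel₀ _ h1, sub_self]

theorem SolvesSystem.pderiv {φ : MvPolynomial (Fin r) ℝ} (h : SolvesSystem r m φ) (k : Fin r) :
    SolvesSystem r m (pderiv k φ) := by
  rw [solvesSystem_iff] at *
  intro i
  rw [← partialOp_apply, ← symbolHom_X, ← Module.End.mul_apply, ← map_mul, mul_comm, map_mul,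
    Module.End.mul_apply, h i, map_zero]

/-- In positive degree some exponent α of φ has α_k > 0, and the coefficient of the k-th derivative
at α - e_k is α_k times that of φ at α. -/
theorem exists_pderiv_ne_zero {φ : MvPolynomial (Fin r) ℝ} {d : ℕ} (h : φ.IsHomogeneous (d + 1))
    (h0 : φ ≠ 0) : ∃ k, MvPolynomial.pderiv k φ ≠ 0 := by
  obtain ⟨α, hα⟩ := exists_coeff_ne_zero h0
  have h1 : α.degree = d + 1 := by
    by_contra h2
    exact hα (h.coeff_eq_zero h2)
  have h2 : α ≠ 0 := by
    rintro rfl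
    simp at h1
  obtain ⟨k, hk⟩ := Finsupp.ne_iff.1 h2
  refine ⟨k, fun h3 => hα ?_⟩
  have h4 := coeff_pderiv φ (i := k) (α - Finsupp.single k 1)
  rw [h3, coeff_zero, tsub_add_cancel_of_le
    (Finsupp.single_le_iff.2 (Nat.one_le_iff_ne_zero.2 hk))] at h4
  exact (mul_eq_zero.1 h4.symm).resolve_right (by positivity)

/-- The derivatives of a nonzero homogeneous solution provide solutions in all lower degrees. -/
theorem exists_solution_of_le {φ : MvPolynomial (Fin r) ℝ} {n : ℕ} (h : SolvesSystem r m φ)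
    (h0 : φ ≠ 0) (hn : φ.IsHomogeneous n) {d : ℕ} (hd : d ≤ n) :
    ∃ ψ : MvPolynomial (Fin r) ℝ, ψ ≠ 0 ∧ ψ.IsHomogeneous d ∧ SolvesSystem r m ψ := by
  induction hd using Nat.decreasingInduction with
  | self => exact ⟨φ, h0, hn, h⟩
  | of_succ k _ ih =>
    obtain ⟨ψ, h1, h2, h3⟩ := ih
    obtain ⟨i, hi⟩ := exists_pderiv_ne_zero h2 h1
    exact ⟨_, hi, h2.pderiv, h3.pderiv i⟩

end Lex

/-! ### Antiderivatives along the roots -/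

section Antiderivative

variable {r : ℕ}

/-- The antiderivative in the variable `s` that vanishes where this variable is zero. -/
def antiderivVar (s : Fin r) : Module.End ℝ (MvPolynomial (Fin r) ℝ) :=
  (basisMonomials (Fin r) ℝ).constr ℝ fun α =>
    monomial (α + Finsupp.single s 1) (α s + 1 : ℝ)⁻¹

theorem antiderivVar_monomial (s : Fin r) (α : Fin r →₀ ℕ) (c : ℝ) :
    antiderivVar s (monomial α c) = monomial (α + Finsupp.single s 1) (c * (α s + 1 : ℝ)⁻¹) := by
  have h : monomial α c = c • basisMonomials (Fin r) ℝ α := by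
    simp [smul_monomial]
  rw [h, map_smul, antiderivVar, Module.Basis.constr_basis, smul_monomial, smul_eq_mul]

theorem pderiv_antiderivVar_self (s : Fin r) (p : MvPolynomial (Fin r) ℝ) :
    pderiv s (antiderivVar s p) = p := by
  induction p using MvPolynomial.induction_on' with
  | monomial α c =>
    have : (α s + 1 : ℝ) ≠ 0 := by positivity
    rw [antiderivVar_monomial, pderiv_monomial, add_tsub_cancel_right]
    simp [this]
  | add p q hp hq => rw [map_add, map_add, hp, hq]

theorem pderiv_antiderivVar_comm {s k : Fin r} (h : k ≠ s) (p : MvPolynomial (Fin r) ℝ) :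
    pderiv k (antiderivVar s p) = antiderivVar s (pderiv k p) := by
  induction p using MvPolynomial.induction_on' with
  | monomial α c =>
    rw [antiderivVar_monomial, pderiv_monomial, pderiv_monomial, antiderivVar_monomial]
    -- If α_k = 0, both sides vanish through the scalar factor; otherwise the truncated subtraction
    -- is a true one.
    by_cases hk : α k = 0
    · simp [hk, h]
    · have h1 : α + Finsupp.single s 1 - Finsupp.single k 1
          = α - Finsupp.single k 1 + Finsupp.single s 1 :=
        (tsub_add_eq_add_tsub (Finsupp.single_le_iff.2 (Nat.one_le_iff_ne_zero.2 hk))).symm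
      rw [h1]
      simp [h, h.symm, mul_right_comm]
  | add p q hp hq => simp only [map_add, hp, hq]

theorem isHomogeneous_antiderivVar (s : Fin r) {p : MvPolynomial (Fin r) ℝ} {d : ℕ}
    (h : p.IsHomogeneous d) : (antiderivVar s p).IsHomogeneous (d + 1) := by
  rw [p.as_sum, map_sum]
  refine IsHomogeneous.sum _ _ _ fun α hα => ?_
  rw [antiderivVar_monomial]
  refine isHomogeneous_monomial _ ?_
  rw [map_add, Finsupp.degree_single]
  congr 1
  by_contra h1
  exact mem_support_iff.1 hα (h.coeff_eq_zero h1)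

theorem eval_antiderivVar (s : Fin r) (a : Fin r → ℝ) (p : MvPolynomial (Fin r) ℝ) :
    eval a (antiderivVar s p) = ∫ u in (0 : ℝ)..a s, eval (Function.update a s u) p := by
  induction p using MvPolynomial.induction_on' with
  | monomial α c =>
    have h : ∀ (b : Fin r → ℝ), ∏ i, b i ^ α i
        = b s ^ α s * ∏ i ∈ Finset.univ.erase s, b i ^ α i := fun b =>
      (Finset.mul_prod_erase _ _ (Finset.mem_univ s)).symm
    have h1 : ∀ u, eval (Function.update a s u) (monomial α c)
        = u ^ α s * (c * ∏ i ∈ Finset.univ.erase s, a i ^ α i) := by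
      intro u
      rw [eval_monomial, Finsupp.prod_fintype _ _ (by simp), h, Function.update_self,
        Finset.prod_congr rfl fun i hi => by
          rw [Function.update_of_ne (Finset.ne_of_mem_erase hi)]]
      ring
    simp only [h1]
    rw [intervalIntegral.integral_mul_const, integral_pow, antiderivVar_monomial, eval_monomial,
      Finsupp.prod_fintype _ _ (by simp)]
    have h2 : ∏ i, a i ^ ((α + Finsupp.single s 1 : Fin r →₀ ℕ) i) = a s * ∏ i, a i ^ α i := by
      simp only [Finsupp.add_apply, pow_add, Finset.prod_mul_distrib]
      simp [Finsupp.single_apply, mul_comm]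
    rw [h2, h]
    field_simp
    ring
  | add p q hp hq =>
    have hc : ∀ p : MvPolynomial (Fin r) ℝ,
        Continuous fun u => eval (Function.update a s u) p := fun p =>
      (MvPolynomial.continuous_eval p).comp (continuous_const.update s continuous_id)
    simp only [map_add, hp, hq]
    rw [intervalIntegral.integral_add ((hc p).intervalIntegrable _ _)
      ((hc q).intervalIntegrable _ _)]

/-- The substitution that adds multiples of the variable `s` to the variables. -/
def shear (s : Fin r) (c : Fin r → ℝ) : MvPolynomial (Fin r) ℝ →ₐ[ℝ] MvPolynomial (Fin r) ℝ :=
  aeval fun k => X k + C (c k) * X s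

theorem shear_X (s : Fin r) (c : Fin r → ℝ) (k : Fin r) :
    shear s c (X k) = X k + C (c k) * X s := by
  simp [shear]

theorem shear_shear_neg {s : Fin r} {c : Fin r → ℝ} (hc : c s = 0) (p : MvPolynomial (Fin r) ℝ) :
    shear s c (shear s (-c) p) = p := by
  rw [← AlgHom.comp_apply]
  refine DFunLike.congr_fun (g := AlgHom.id ℝ _) (algHom_ext fun k => ?_) p
  simp [shear_X, hc, algHom_C]

theorem isHomogeneous_shear (s : Fin r) (c : Fin r → ℝ) {p : MvPolynomial (Fin r) ℝ} {d : ℕ}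
    (h : p.IsHomogeneous d) : (shear s c p).IsHomogeneous d := by
  have h1 := h.aeval (fun k => X k + C (c k) * X s : Fin r → MvPolynomial (Fin r) ℝ) (n := 1)
    fun k => (isHomogeneous_X _ k).add (isHomogeneous_C_mul_X _ _)
  rwa [one_mul] at h1

theorem eval_shear (s : Fin r) (c a : Fin r → ℝ) (p : MvPolynomial (Fin r) ℝ) :
    eval a (shear s c p) = eval (fun k => a k + c k * a s) p := by
  induction p using MvPolynomial.induction_on with
  | C b => simp [algHom_C]
  | add p q hp hq => simp only [map_add, hp, hq]
  | mul_X p k hp => simp [hp, shear_X]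

/-- An algebra homomorphism that intertwines two derivations on the variables intertwines
them. -/
theorem derivation_map_eq {D E : Derivation ℝ (MvPolynomial (Fin r) ℝ) (MvPolynomial (Fin r) ℝ)}
    {T : MvPolynomial (Fin r) ℝ →ₐ[ℝ] MvPolynomial (Fin r) ℝ}
    (h : ∀ k, D (T (X k)) = T (E (X k))) (p : MvPolynomial (Fin r) ℝ) : D (T p) = T (E p) := by
  induction p using MvPolynomial.induction_on with
  | C a => simp [algHom_C, derivation_C]
  | add p q hp hq => simp only [map_add, hp, hq]
  | mul_X p k hp => simp only [map_mul, Derivation.leibniz, h, hp, map_add, smul_eq_mul]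

/-- The coordinates of the basis vector of a node; they are zero at the last node. -/
def nodeCoord (t : Fin (r + 1)) (k : Fin r) : ℝ := if k.castSucc = t then 1 else 0

/-- The derivative in the variable attached to a node. -/
def nodeDeriv (t : Fin (r + 1)) :
    Derivation ℝ (MvPolynomial (Fin r) ℝ) (MvPolynomial (Fin r) ℝ) :=
  Fin.lastCases (motive := fun _ => Derivation ℝ (MvPolynomial (Fin r) ℝ) _) 0 pderiv t

theorem symbolHom_nodeVar (t : Fin (r + 1)) (p : MvPolynomial (Fin r) ℝ) :
    symbolHom r (nodeVar t) p = nodeDeriv t p := by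
  induction t using Fin.lastCases with
  | last => simp [nodeDeriv]
  | cast j => simp [nodeDeriv, partialOp_apply]

theorem nodeDeriv_X (t : Fin (r + 1)) (k : Fin r) :
    nodeDeriv t (X k) = C (nodeCoord t k) := by
  induction t using Fin.lastCases with
  | last => simp [nodeDeriv, nodeCoord, Fin.castSucc_ne_last]
  | cast j => simp [nodeDeriv, nodeCoord, pderiv_X, Pi.single_apply, apply_ite C]

theorem nodeCoord_self {s : Fin r} {t : Fin (r + 1)} (h : s.castSucc < t) : nodeCoord t s = 0 :=
  if_neg h.ne

/-- The antiderivative along the root from node `s` to node `t` that vanishes where the variable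
`s` is zero. -/
def rootAntideriv (s : Fin r) (t : Fin (r + 1)) (p : MvPolynomial (Fin r) ℝ) :
    MvPolynomial (Fin r) ℝ :=
  shear s (nodeCoord t) (antiderivVar s (shear s (-nodeCoord t) p))

/-- The shear x_t ↦ x_t + x_s conjugates ∂_s - ∂_t to ∂_s, since x_t + x_s is killed by the former.
At the last node the shear is the identity. -/
theorem symbolHom_root_rootAntideriv {s : Fin r} {t : Fin (r + 1)} (h : s.castSucc < t)
    (p : MvPolynomial (Fin r) ℝ) :
    symbolHom r (X s - nodeVar t) (rootAntideriv s t p) = p := by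
  have h1 : ∀ q, (pderiv s - nodeDeriv t :
      Derivation ℝ (MvPolynomial (Fin r) ℝ) (MvPolynomial (Fin r) ℝ)) (shear s (nodeCoord t) q)
      = shear s (nodeCoord t) (pderiv s q) := by
    refine derivation_map_eq fun k => ?_
    simp only [shear_X, map_add, Derivation.sub_apply, Derivation.leibniz, nodeDeriv_X,
      derivation_C, pderiv_X_self, nodeCoord_self h, smul_eq_mul]
    rw [pderiv_X]
    by_cases hk : s = k
    · subst hk
      simp [nodeCoord_self h]
    · simp [Ne.symm hk]
  rw [map_sub, LinearMap.sub_apply, symbolHom_X, partialOp_apply, symbolHom_nodeVar,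
    ← Derivation.sub_apply, rootAntideriv, h1, pderiv_antiderivVar_self,
    shear_shear_neg (nodeCoord_self h)]

/-- The shear only adds multiples of x_s to the variables, so only the derivative in x_s is
affected; in particular k may be the node t of a root. -/
theorem pderiv_shear {s k : Fin r} (h : k ≠ s) (c : Fin r → ℝ) (p : MvPolynomial (Fin r) ℝ) :
    pderiv k (shear s c p) = shear s c (pderiv k p) := by
  refine derivation_map_eq (fun l => ?_) p
  simp only [shear_X, map_add, pderiv_mul, pderiv_C, pderiv_X_of_ne h.symm, pderiv_X]
  by_cases hk : l = k <;> simp [hk]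

theorem pderiv_rootAntideriv_comm {s k : Fin r} (h : k ≠ s) (t : Fin (r + 1))
    (p : MvPolynomial (Fin r) ℝ) :
    pderiv k (rootAntideriv s t p) = rootAntideriv s t (pderiv k p) := by
  rw [rootAntideriv, rootAntideriv, pderiv_shear h, pderiv_antiderivVar_comm h, pderiv_shear h]

theorem rootAntideriv_zero (s : Fin r) (t : Fin (r + 1)) :
    rootAntideriv s t (0 : MvPolynomial (Fin r) ℝ) = 0 := by
  simp [rootAntideriv]

theorem rootAntideriv_sub (s : Fin r) (t : Fin (r + 1)) (p q : MvPolynomial (Fin r) ℝ) :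
    rootAntideriv s t (p - q) = rootAntideriv s t p - rootAntideriv s t q := by
  simp [rootAntideriv]

theorem rootAntideriv_ne_zero {s : Fin r} {t : Fin (r + 1)} (h : s.castSucc < t)
    {p : MvPolynomial (Fin r) ℝ} (hp : p ≠ 0) : rootAntideriv s t p ≠ 0 := by
  intro h0
  apply hp
  rw [← symbolHom_root_rootAntideriv h p, h0, map_zero]

theorem isHomogeneous_rootAntideriv (s : Fin r) (t : Fin (r + 1)) {p : MvPolynomial (Fin r) ℝ}
    {d : ℕ} (h : p.IsHomogeneous d) : (rootAntideriv s t p).IsHomogeneous (d + 1) :=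
  isHomogeneous_shear _ _ (isHomogeneous_antiderivVar _ (isHomogeneous_shear _ _ h))

theorem eval_rootAntideriv {s : Fin r} {t : Fin (r + 1)} (h : s.castSucc < t) (a : Fin r → ℝ)
    (p : MvPolynomial (Fin r) ℝ) :
    eval a (rootAntideriv s t p)
      = ∫ z in (0 : ℝ)..a s, eval (fun k => a k - z * (nodeCoord s.castSucc k - nodeCoord t k)) p := by
  have hs := nodeCoord_self h
  rw [rootAntideriv, eval_shear, eval_antiderivVar]
  simp only [hs, zero_mul, add_zero]
  -- The substitution u = a_s - z turns the value u of the variable s into the flow z sent along the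
  -- root.
  have h1 := intervalIntegral.integral_comp_sub_left (a := 0) (b := a s)
    (fun z => eval (fun k => a k - z * (nodeCoord s.castSucc k - nodeCoord t k)) p) (a s)
  rw [sub_self, sub_zero] at h1
  rw [← h1]
  refine intervalIntegral.integral_congr fun u _ => ?_
  simp only [eval_shear, Function.update_self]
  congr 2
  funext k
  by_cases hk : k = s
  · subst hk
    simp [hs, show nodeCoord k.castSucc k = 1 from if_pos rfl]
  · have : nodeCoord s.castSucc k = 0 := by simp [nodeCoord, hk]
    rw [Function.update_of_ne hk, Pi.neg_apply, this]
    ring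

end Antiderivative

/-! ### Iterated antiderivatives and volumes -/

section Chain

variable {r : ℕ}

/-- The iterated antiderivative of the constant polynomial `1` along a sequence of roots. -/
def chainPoly : ∀ {n : ℕ}, (Fin n → Fin r × Fin (r + 1)) → MvPolynomial (Fin r) ℝ
  | 0, _ => 1
  | _ + 1, e => rootAntideriv (e 0).1 (e 0).2 (chainPoly fun k => e k.succ)

theorem chainPoly_zero (e : Fin 0 → Fin r × Fin (r + 1)) : chainPoly e = 1 := by
  rw [chainPoly]

theorem chainPoly_succ {n : ℕ} (e : Fin (n + 1) → Fin r × Fin (r + 1)) :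
    chainPoly e = rootAntideriv (e 0).1 (e 0).2 (chainPoly fun k => e k.succ) := by
  rw [chainPoly]

theorem isHomogeneous_chainPoly {n : ℕ} (e : Fin n → Fin r × Fin (r + 1)) :
    (chainPoly e).IsHomogeneous n := by
  induction n with
  | zero => exact chainPoly_zero e ▸ isHomogeneous_one _ _
  | succ n ih => exact chainPoly_succ e ▸ isHomogeneous_rootAntideriv _ _ (ih _)

theorem chainPoly_ne_zero {n : ℕ} {e : Fin n → Fin r × Fin (r + 1)}
    (he : ∀ k, (e k).1.castSucc < (e k).2) : chainPoly e ≠ 0 := by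
  induction n with
  | zero => exact chainPoly_zero e ▸ one_ne_zero
  | succ n ih => exact chainPoly_succ e ▸ rootAntideriv_ne_zero (he 0) (ih fun k => he k.succ)

theorem symbolHom_rootAntideriv_comm {s i : Fin r} {t : Fin (r + 1)} (hi : i ≠ s)
    (ht : t ≠ s.castSucc) (u : Fin (r + 1)) (q : MvPolynomial (Fin r) ℝ) :
    symbolHom r (X i - nodeVar t) (rootAntideriv s u q)
      = rootAntideriv s u (symbolHom r (X i - nodeVar t) q) := by
  induction t using Fin.lastCases with
  | last => simp [partialOp_apply, pderiv_rootAntideriv_comm hi]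
  | cast j =>
    have hj : j ≠ s := fun h => ht (by rw [h])
    simp [partialOp_apply, pderiv_rootAntideriv_comm hi, pderiv_rootAntideriv_comm hj,
      rootAntideriv_sub]

theorem symbolHom_prod_rootAntideriv_comm {ι : Type*} {s i : Fin r} (hi : i ≠ s)
    (A : Finset ι) (t : ι → Fin (r + 1)) (ht : ∀ k ∈ A, t k ≠ s.castSucc) (u : Fin (r + 1))
    (q : MvPolynomial (Fin r) ℝ) :
    symbolHom r (∏ k ∈ A, (X i - nodeVar (t k))) (rootAntideriv s u q)
      = rootAntideriv s u (symbolHom r (∏ k ∈ A, (X i - nodeVar (t k))) q) := by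
  refine Finset.prod_induction (fun k => X i - nodeVar (t k)) (fun p => ∀ q,
    symbolHom r p (rootAntideriv s u q) = rootAntideriv s u (symbolHom r p q)) ?_ ?_ ?_ q
  · intro p p' hp hp' q
    simp [map_mul, hp, hp']
  · simp
  · exact fun k hk q => symbolHom_rootAntideriv_comm hi (ht k hk) u q

/-- If the outermost root starts at i, its own factor undoes it. If not, the whole operator commutes
with that antiderivative: by the sorting, the factors for the remaining roots from i do not involve
its source. In the end ∂_i meets the constant 1. -/
theorem symbolHom_chainPoly_eq_zero {n : ℕ} {e : Fin n → Fin r × Fin (r + 1)}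
    (he : ∀ k, (e k).1.castSucc < (e k).2) (hmono : Monotone fun k => (e k).1) (i : Fin r) :
    symbolHom r ((∏ k with (e k).1 = i, (X i - nodeVar (e k).2)) * X i) (chainPoly e) = 0 := by
  induction n with
  | zero => simp [chainPoly_zero, partialOp_apply]
  | succ n ih =>
    have ih' := ih (e := fun k => e k.succ) (fun k => he k.succ)
      (fun k l h => hmono (Fin.succ_le_succ_iff.2 h))
    rw [chainPoly_succ]
    by_cases h0 : (e 0).1 = i
    · rw [Finset.prod_filter, Fin.prod_univ_succ, ← Finset.prod_filter, if_pos h0, mul_assoc,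
        mul_comm, map_mul, Module.End.mul_apply]
      have h1 := symbolHom_root_rootAntideriv (he 0) (chainPoly fun k => e k.succ)
      rw [h0] at h1 ⊢
      rw [h1, ih']
    · have h1 : (∏ k with (e k).1 = i, (X i - nodeVar (e k).2) : MvPolynomial (Fin r) ℝ)
          = ∏ k with (e (Fin.succ k)).1 = i, (X i - nodeVar (e k.succ).2) := by
        rw [Finset.prod_filter, Fin.prod_univ_succ, ← Finset.prod_filter, if_neg h0, one_mul]
      rw [h1]
      rw [map_mul, Module.End.mul_apply, symbolHom_X, partialOp_apply,
        pderiv_rootAntideriv_comm (Ne.symm h0), symbolHom_prod_rootAntideriv_comm (Ne.symm h0),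
        ← partialOp_apply, ← symbolHom_X, ← Module.End.mul_apply, ← map_mul, ih',
        rootAntideriv_zero]
      intro k hk h2
      have h3 := he k.succ
      have h4 := hmono (Fin.zero_le k.succ)
      rw [h2, Fin.castSucc_lt_castSucc_iff] at h3
      exact h4.not_gt h3

/-- The region of the nonnegative flows along a sequence of roots whose excess is at most `a`. -/
def chainRegion {n : ℕ} (e : Fin n → Fin r × Fin (r + 1)) (a : Fin r → ℝ) : Set (Fin n → ℝ) :=
  {z | (∀ k, 0 ≤ z k) ∧
    ∀ i, ∑ k, z k * (nodeCoord (e k).1.castSucc i - nodeCoord (e k).2 i) ≤ a i}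

theorem measurableSet_chainRegion {n : ℕ} (e : Fin n → Fin r × Fin (r + 1)) (a : Fin r → ℝ) :
    MeasurableSet (chainRegion e a) := by
  have h : chainRegion e a = (⋂ k, {z | 0 ≤ z k}) ∩
      ⋂ i, {z | ∑ k, z k * (nodeCoord (e k).1.castSucc i - nodeCoord (e k).2 i) ≤ a i} := by
    ext z
    simp [chainRegion]
  rw [h]
  exact (MeasurableSet.iInter fun k => measurableSet_le (by fun_prop) (by fun_prop)).inter
    (MeasurableSet.iInter fun i => measurableSet_le (by fun_prop) (by fun_prop))

/-- Sections of a region over the first flow are regions of the same kind with shifted bounds, which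
makes Fubini inductive. -/
theorem cons_mem_chainRegion {n : ℕ} {e : Fin (n + 1) → Fin r × Fin (r + 1)} {a : Fin r → ℝ}
    {x : ℝ} {z : Fin n → ℝ} :
    (Fin.cons x z : Fin (n + 1) → ℝ) ∈ chainRegion e a ↔ 0 ≤ x ∧ z ∈ chainRegion
      (fun k => e k.succ)
      (fun i => a i - x * (nodeCoord (e 0).1.castSucc i - nodeCoord (e 0).2 i)) := by
  simp only [chainRegion, Set.mem_ofPred_eq, Fin.forall_fin_succ, Fin.sum_univ_succ, Fin.cons_zero,
    Fin.cons_succ, and_assoc, le_sub_iff_add_le']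

/-- No flow enters a node from which all later arcs start. -/
theorem nonneg_of_mem_chainRegion {n : ℕ} {e : Fin n → Fin r × Fin (r + 1)} {a : Fin r → ℝ}
    {z : Fin n → ℝ} (hz : z ∈ chainRegion e a) {s : Fin r}
    (hs : ∀ k, s.castSucc < (e k).2) : 0 ≤ a s := by
  refine le_trans (Finset.sum_nonneg fun k _ => mul_nonneg (hz.1 k) ?_) (hz.2 s)
  rw [nodeCoord_self (hs k), sub_zero, nodeCoord]
  split_ifs <;> norm_num

/-- Induction by Fubini over the first flow. Nonnegativity is carried along because `ENNReal.ofReal`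
truncates negative values. -/
theorem volume_chainRegion {n : ℕ} {e : Fin n → Fin r × Fin (r + 1)}
    (he : ∀ k, (e k).1.castSucc < (e k).2) (hmono : Monotone fun k => (e k).1)
    {a : Fin r → ℝ} (ha : ∀ i, 0 ≤ a i) :
    0 ≤ eval a (chainPoly e) ∧
      volume (chainRegion e a) = ENNReal.ofReal (eval a (chainPoly e)) := by
  induction n generalizing a with
  | zero =>
    have : chainRegion e a = Set.univ := by
      ext z
      simp [chainRegion, ha]
    simp [chainPoly_zero, this, volume_pi]
  | succ n ih =>
    set s := (e 0).1
    set t := (e 0).2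
    set b : ℝ → Fin r → ℝ := fun x i => a i - x * (nodeCoord s.castSucc i - nodeCoord t i)
    set f : ℝ → ℝ := fun x => eval (b x) (chainPoly fun k => e k.succ)
    have hst : s.castSucc < t := he 0
    have ih' : ∀ x ∈ Set.Icc 0 (a s), 0 ≤ f x ∧
        volume (chainRegion (fun k => e k.succ) (b x)) = ENNReal.ofReal (f x) := by
      intro x hx
      refine ih (fun k => he k.succ) (fun k l h => hmono (Fin.succ_le_succ_iff.2 h)) fun i => ?_
      -- The shifted bound stays nonnegative: only the coordinate s decreases, by x ≤ a_s.
      have h1 : x * nodeCoord s.castSucc i ≤ a i := by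
        by_cases h : i = s
        · subst h
          simpa [nodeCoord] using hx.2
        · simpa [nodeCoord, h] using ha i
      have h2 : 0 ≤ x * nodeCoord t i := by
        refine mul_nonneg hx.1 ?_
        rw [nodeCoord]
        split_ifs <;> norm_num
      simp only [b]
      linarith
    have hf : Continuous f := by
      refine (MvPolynomial.continuous_eval _).comp ?_
      fun_prop
    have hint : eval a (chainPoly e) = ∫ x in Set.Icc 0 (a s), f x := by
      rw [chainPoly_succ, eval_rootAntideriv hst, intervalIntegral.integral_of_le (ha s),
        integral_Icc_eq_integral_Ioc]
    have hvol : volume (chainRegion e a)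
        = ∫⁻ x, volume {z : Fin n → ℝ | (Fin.cons x z : Fin (n + 1) → ℝ) ∈ chainRegion e a} := by
      have hp := (volume_preserving_piFinSuccAbove (fun _ : Fin (n + 1) => ℝ) 0).symm
      rw [← hp.measure_preimage_equiv, Measure.volume_eq_prod, Measure.prod_apply]
      · simp [Set.preimage]
        rfl
      · exact (MeasurableEquiv.measurable _) (measurableSet_chainRegion e a)
    have hsec : ∀ x, volume {z : Fin n → ℝ | (Fin.cons x z : Fin (n + 1) → ℝ) ∈ chainRegion e a}
        = (Set.Icc 0 (a s)).indicator (fun x => ENNReal.ofReal (f x)) x := by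
      intro x
      simp only [cons_mem_chainRegion]
      by_cases hx : x ∈ Set.Icc 0 (a s)
      · rw [Set.indicator_of_mem hx, ← (ih' x hx).2]
        simp only [hx.1, true_and, Set.ofPred_mem_eq]
        rfl
      · rw [Set.indicator_of_notMem hx]
        convert measure_empty (μ := (volume : Measure (Fin n → ℝ)))
        -- If x > a_s, the bound at s is negative, while by the sorting no later arc enters s; so
        -- the section is empty.
        refine Set.eq_empty_of_forall_notMem fun z hz => hx ⟨hz.1, ?_⟩
        have h1 := nonneg_of_mem_chainRegion hz.2 (s := s) fun k =>
          (Fin.castSucc_le_castSucc_iff.2 (hmono (Fin.zero_le k.succ))).trans_lt (he k.succ)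
        change 0 ≤ a s - x * (nodeCoord s.castSucc s - nodeCoord t s) at h1
        rw [nodeCoord_self hst] at h1
        simpa [nodeCoord] using h1
    have hnn : ∀ᵐ x ∂volume.restrict (Set.Icc 0 (a s)), 0 ≤ f x :=
      (ae_restrict_iff' measurableSet_Icc).2 (Filter.Eventually.of_forall fun x hx => (ih' x hx).1)
    rw [hint, hvol]
    refine ⟨integral_nonneg_of_ae hnn, ?_⟩
    simp only [hsec]
    rw [lintegral_indicator measurableSet_Icc, ofReal_integral_eq_lintegral_ofReal _ hnn]
    exact hf.continuousOn.integrableOn_Icc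

end Chain

/-! ### The volume of the flow polytope -/

section Volume

variable {r : ℕ} {m : Fin (r + 1) → Fin (r + 1) → ℕ}

/-- The node that an arc leaves. -/
def arcSource (e : Arc r m) : Fin r :=
  e.1.1.1.castPred (e.1.2.trans_le (Fin.le_last _)).ne

@[simp]
theorem castSucc_arcSource (e : Arc r m) : (arcSource e).castSucc = e.1.1.1 :=
  Fin.castSucc_castPred _ _

/-- The number of arcs that are not basic, the dimension of the flow polytope. -/
def flowDim (r : ℕ) (m : Fin (r + 1) → Fin (r + 1) → ℕ) : ℕ :=
  Fintype.card {e : Arc r m // ¬ IsBasic e}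

theorem flowDim_add (hm : ∀ i j, i < j → 0 < m i j) : flowDim r m + r = totalMult r m := by
  have h1 := Fintype.card_subtype_compl (IsBasic : Arc r m → Prop)
  have h2 := Fintype.card_subtype_le (IsBasic : Arc r m → Prop)
  have h3 := Fintype.card_congr (basicEquiv hm)
  rw [Fintype.card_fin] at h3
  rw [flowDim, h1, ← card_arc]
  omega

variable (m) in
/-- An enumeration of the arcs that are not basic by increasing source. -/
theorem exists_sorted_equiv : ∃ ε : Fin (flowDim r m) ≃ {e : Arc r m // ¬ IsBasic e},
    Monotone fun k => arcSource (ε k).1 := by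
  let f := fun k => arcSource ((Fintype.equivFin {e : Arc r m // ¬ IsBasic e}).symm k).1
  exact ⟨(Tuple.sort f).trans (Fintype.equivFin _).symm, Tuple.monotone_sort f⟩

/-- The arcs that are not basic, by increasing source. -/
def sortedArcs (r : ℕ) (m : Fin (r + 1) → Fin (r + 1) → ℕ) :
    Fin (flowDim r m) ≃ {e : Arc r m // ¬ IsBasic e} :=
  (exists_sorted_equiv m).choose

/-- The pairs of endpoints of the arcs that are not basic, by increasing source. -/
def sortedEnds (r : ℕ) (m : Fin (r + 1) → Fin (r + 1) → ℕ) (k : Fin (flowDim r m)) :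
    Fin r × Fin (r + 1) :=
  (arcSource (sortedArcs r m k).1, (sortedArcs r m k).1.1.1.2)

theorem monotone_sortedEnds : Monotone fun k => (sortedEnds r m k).1 :=
  (exists_sorted_equiv m).choose_spec

theorem sortedEnds_lt (k : Fin (flowDim r m)) :
    (sortedEnds r m k).1.castSucc < (sortedEnds r m k).2 := by
  rw [sortedEnds, castSucc_arcSource]
  exact (sortedArcs r m k).1.1.2

/-- The separate factor x_i comes from the basic arc leaving i, which ends at the last node. -/
theorem systemSymbol_eq (hm : ∀ i j, i < j → 0 < m i j) (i : Fin r) :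
    systemSymbol m i = (∏ k with (sortedEnds r m k).1 = i,
      (X i - nodeVar (sortedEnds r m k).2)) * X i := by
  have h : ∀ e : Arc r m, e.1.1.1 = i.castSucc ↔ arcSource e = i := fun e => by
    rw [← castSucc_arcSource, Fin.castSucc_inj]
  rw [systemSymbol, arcsFrom, Finset.prod_filter, Finset.prod_filter,
    ← Fintype.prod_subtype_mul_prod_subtype (fun e : Arc r m => IsBasic e), mul_comm]
  congr 1
  · rw [← (sortedArcs r m).prod_comp]
    simp only [h, sortedEnds]
    rfl
  · rw [← (basicEquiv hm).prod_comp]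
    simp [basicEquiv, basicArc]

/-- The volume polynomial of the flow polytope on the nice chamber. -/
def volumePoly (r : ℕ) (m : Fin (r + 1) → Fin (r + 1) → ℕ) : MvPolynomial (Fin r) ℝ :=
  chainPoly (sortedEnds r m)

theorem isHomogeneous_volumePoly : (volumePoly r m).IsHomogeneous (flowDim r m) :=
  isHomogeneous_chainPoly _

theorem volumePoly_ne_zero : volumePoly r m ≠ 0 :=
  chainPoly_ne_zero sortedEnds_lt

theorem solvesSystem_volumePoly (hm : ∀ i j, i < j → 0 < m i j) :
    SolvesSystem r m (volumePoly r m) := by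
  rw [solvesSystem_iff]
  intro i
  rw [systemSymbol_eq hm]
  exact symbolHom_chainPoly_eq_zero sortedEnds_lt monotone_sortedEnds i

theorem arcRoot_castSucc (e : Arc r m) (i : Fin r) :
    arcRoot e i.castSucc = nodeCoord e.1.1.1 i - nodeCoord e.1.1.2 i := by
  simp [arcRoot, root, nodeCoord, Pi.single_apply]

/-- The basic coordinates are slack variables: their nonnegativity is the inequality at their
source. -/
theorem fibrePoint_mem_flowPolytope (hm : ∀ i j, i < j → 0 < m i j) (a : Fin r → ℝ)
    (z : {e : Arc r m // ¬ IsBasic e} → ℝ) : fibrePoint a z ∈ flowPolytope r m a ↔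
      (∀ f, 0 ≤ z f) ∧ ∀ i, ∑ f, z f * arcRoot f.1 i.castSucc ≤ a i := by
  simp only [flowPolytope, Set.mem_ofPred_eq, rootSum_fibrePoint hm, and_true]
  constructor
  · intro h
    refine ⟨fun f => fibrePoint_nonbasic a z f ▸ h f.1, fun i => ?_⟩
    have := h (basicArc hm i).1
    rwa [fibrePoint_basicArc, sub_nonneg] at this
  · rintro ⟨h1, h2⟩ e
    by_cases he : IsBasic e
    · obtain ⟨i, hi⟩ := (basicArc_bijective hm).2 ⟨e, he⟩
      have h3 : (basicArc hm i).1 = e := by rw [hi]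
      rw [← h3, fibrePoint_basicArc, sub_nonneg]
      exact h2 i
    · exact (fibrePoint_nonbasic a z ⟨e, he⟩).symm ▸ h1 ⟨e, he⟩

theorem measurableSet_flowPolytope (a : Fin r → ℝ) : MeasurableSet (flowPolytope r m a) := by
  have h : flowPolytope r m a = (⋂ e, {y | 0 ≤ y e}) ∩ {y | rootSum y = toV a} := by
    ext y
    simp [flowPolytope]
  rw [h]
  refine (MeasurableSet.iInter fun e => measurableSet_le (by fun_prop) (by fun_prop)).inter
    (measurableSet_eq_fun ?_ measurable_const)
  unfold rootSum
  fun_prop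

theorem fibreMeasure_flowPolytope (hm : ∀ i j, i < j → 0 < m i j) (a : Fin r → ℝ) :
    fibreMeasure r m a (flowPolytope r m a) = volume (chainRegion (sortedEnds r m) a) := by
  rw [fibreMeasure, Measure.map_apply (measurable_fibrePoint a) (measurableSet_flowPolytope a),
    ← (volume_measurePreserving_piCongrLeft (fun _ => ℝ) (sortedArcs r m)).measure_preimage_equiv]
  congr 1
  ext z
  have h : ∀ k, MeasurableEquiv.piCongrLeft (fun _ => ℝ) (sortedArcs r m) z (sortedArcs r m k)
      = z k := fun k => Equiv.piCongrLeft_apply_apply (fun _ => ℝ) (sortedArcs r m) z k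
  simp only [Set.mem_preimage, fibrePoint_mem_flowPolytope hm, ← (sortedArcs r m).forall_congr_right,
    ← (sortedArcs r m).sum_comp, h, arcRoot_castSucc, chainRegion, Set.mem_ofPred_eq, sortedEnds,
    castSucc_arcSource]

theorem isNiceVolumePolynomial_volumePoly (hm : ∀ i j, i < j → 0 < m i j) :
    IsNiceVolumePolynomial r m (volumePoly r m) := by
  intro a ha
  -- The volume formula needs only a ≥ 0, so no limit argument is required on the boundary of the
  -- chamber.
  have ha : ∀ i, 0 ≤ a i := by
    have hc : IsClosed {a : Fin r → ℝ | ∀ i, 0 ≤ a i} := by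
      rw [Set.ofPred_forall]
      exact isClosed_iInter fun i => isClosed_le continuous_const (continuous_apply i)
    exact closure_minimal (fun b hb i => (hb i).le) hc ha
  obtain ⟨h1, h2⟩ := volume_chainRegion sortedEnds_lt (monotone_sortedEnds (m := m)) ha
  rw [flowVolume, Measure.real, fibreMeasure_flowPolytope hm, h2, ENNReal.toReal_ofReal h1,
    volumePoly]

end Volume

end FlowPolytope

end

open FlowPolytope in
theorem theorem3p4 (r : ℕ) (hr : 1 ≤ r) (m : Fin (r + 1) → Fin (r + 1) → ℕ)
    (hm : ∀ i j, i < j → 0 < m i j) :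
    (∀ (d : ℕ) (φ : MvPolynomial (Fin r) ℝ), φ.IsHomogeneous d → SolvesSystem r m φ →
      totalMult r m < d + r → φ = 0) ∧
    (∀ d : ℕ, d + r ≤ totalMult r m →
      ∃ φ : MvPolynomial (Fin r) ℝ, φ ≠ 0 ∧ φ.IsHomogeneous d ∧ SolvesSystem r m φ) ∧
    (∃ v : MvPolynomial (Fin r) ℝ, IsNiceVolumePolynomial r m v ∧
      ∀ (d : ℕ) (φ : MvPolynomial (Fin r) ℝ), φ.IsHomogeneous d → SolvesSystem r m φ →
        d + r = totalMult r m → ∃ c : ℝ, φ = MvPolynomial.C c * v) := by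
  have hv := solvesSystem_volumePoly hm
  have hM := flowDim_add hm
  refine ⟨fun d φ hd h hlt => ?_, fun d hd => ?_, volumePoly r m,
    isNiceVolumePolynomial_volumePoly hm, fun d φ hd h hdM => ?_⟩
  · by_contra h0
    exact (h.degree_add_le h0 hd).not_gt hlt
  · exact exists_solution_of_le hv volumePoly_ne_zero isHomogeneous_volumePoly (by omega)
  · obtain rfl : d = flowDim r m := by omega
    exact h.eq_C_mul hv hd isHomogeneous_volumePoly volumePoly_ne_zero hdM
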